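/- Let $V$ be a finite set with $|V| \ge 4$. All directed graphs $\mathcal{G} = (V,E)$ are taken to contain every self-loop $i \to i$, and such a graph is called a DAG if it has no directed cycle of length greater than one (self-loops are ignored). Write $\mathbb{R}^E$ for the set of real $V \times V$ matrices $M = (m_{ij})$ with $m_{ji} = 0$ whenever $i \to j \notin E$, and call $M$ stable if all its complex eigenvalues have strictly negative real part. The Lyapunov model of $\mathcal{G}$ (with uncorrelated noise, volatility matrix $C = 2I$) is $$\mathcal{M}_{\mathcal{G}} = \{\Sigma \text{ positive definite} : M\Sigma + \Sigma M^T + 2I = 0 \text{ for some stable } M \in \mathbb{R}^E\}.$$ Two graphs on the same vertex set are model equivalent if their Lyapunov models are equal. The skeleton of $\mathcal{G}$ is the undirected simple graph on $V$ in which distinct $i,j$ are adjacent iff $i \to j \in E$ or $j \to i \in E$. For $K \subseteq V$, $\mathcal{G}[K]$ denotes the induced subgraph with vertex set $K$. Theorem. Let $\mathcal{G}_1$ and $\mathcal{G}_2$ be DAGs on the vertex set $V$, $|V| \ge 4$. Then $\mathcal{G}_1$ and $\mathcal{G}_2$ are model equivalent if and only if they have the same skeleton and the induced subgraphs $\mathcal{G}_1[K]$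 and $\mathcal{G}_2[K]$ are model equivalent for all $K \subseteq V$ with $|K| = 4$. -/

import Mathlib

/-! Graphs are Mathlib's `Digraph`s; `G.Adj i j` means that `i → j` is an edge. -/

namespace Lyapunov

/-- A directed acyclic graph in the convention of Lyapunov models: every self-loop is an edge,
and, self-loops being ignored, there is no directed cycle. -/
structure IsDAG {V : Type*} (G : Digraph V) : Prop where
  loop : ∀ v, G.Adj v v
  acyclic : ∀ v, ¬ Relation.TransGen (fun i j => i ≠ j ∧ G.Adj i j) v v

/-- The skeleton: `i` and `j` are adjacent iff `i ≠ j` and `i → j` or `j → i` is an edge. -/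
abbrev skeleton {V : Type*} (G : Digraph V) : SimpleGraph V :=
  G.toSimpleGraphInclusive

/-- The induced subgraph `G[K]`, with vertex set `K`. -/
def induce {V : Type*} (G : Digraph V) (K : Finset V) : Digraph K where
  Adj i j := G.Adj i j

/-- The space `ℝ^E` of matrices `M` with `M j i = 0` whenever `i → j` is not an edge. -/
def sparse {V : Type*} (G : Digraph V) : Set (Matrix V V ℝ) :=
  {M | ∀ i j, ¬ G.Adj i j → M j i = 0}

/-- A real matrix is stable if all its complex eigenvalues have negative real part. -/
def IsStable {V : Type*} [Fintype V] [DecidableEq V] (M : Matrix V V ℝ) : Prop :=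
  ∀ z ∈ spectrum ℂ (M.map Complex.ofReal), z.re < 0

/-- The graphical continuous Lyapunov model of `G` with volatility matrix `C`,
as a set of covariance matrices. -/
def modelWith {V : Type*} [Fintype V] [DecidableEq V] (G : Digraph V) (C : Matrix V V ℝ) :
    Set (Matrix V V ℝ) :=
  {S | S.PosDef ∧ ∃ M ∈ sparse G, IsStable M ∧ M * S + S * M.transpose + C = 0}

/-- The Lyapunov model of `G` with volatility matrix `C = 2 I`. -/
def model {V : Type*} [Fintype V] [DecidableEq V] (G : Digraph V) : Set (Matrix V V ℝ) :=
  modelWith G ((2 : ℝ) • (1 : Matrix V V ℝ))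

/-- Model equivalence of two graphs on the same vertex set. -/
def ModelEquiv {V : Type*} [Fintype V] [DecidableEq V] (G₁ G₂ : Digraph V) : Prop :=
  model G₁ = model G₂

end Lyapunov

/-!
The condition `C = 2 I` makes stability automatic: a solution `M` of the Lyapunov equation with
positive definite `Σ` is stable, so `Σ` lies in the model as soon as the linear equation has a
solution of the prescribed sparsity. Dually, `Σ` lies outside the model if some symmetric `Y` with
nonzero trace has `Y Σ` vanishing on all edges. Passing to an induced subgraph amounts to looking at
the block diagonal covariances `diag(S, 1)`, so model equivalence is inherited by induced subgraphs,
and finitely many integer certificates on at most four vertices exclude local configurations.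

Suppose that two DAGs have the same skeleton and agree in this sense on all sets of at most four
vertices. The excluded configurations show that the end points of each edge `i → j` that the two
graphs direct differently have the same neighbours, and that the parents and children of `i` are
linked densely enough to make the following exchange possible. Let `A` consist of `j` and the
parents of `i`, the vertex `i` included, and let `B` consist of the vertices not linked to `i`. Both
sets are ancestral, hence uncorrelated. If `x` and `y` are the columns `i` and `j` of the inverse of
the `A × A` block of `Σ`, extended by zero, then `D = Σ x yᵀ - Σ y xᵀ` solves `D Σ + Σ Dᵀ = 0`, is
supported on the edges of the graph and on `j → i`, and is nonzero at `i → j`. Subtracting from `M`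
the multiple of `D` that kills the entry of `i → j` reverses that edge within the model. Reversing
the edges one at a time, always one with no vertex strictly between its end points, leads from one
graph to the other.
-/

namespace Lyapunov

open Matrix

section Layering

variable {V : Type*} {G : Digraph V} {r : V → ℕ} {a b c : V}

/-- A layering of `G`: a labelling of the vertices that strictly increases along every edge other
than the self-loops. Among the graphs with all self-loops, the DAGs are those with a layering. -/
def IsLayering (G : Digraph V) (r : V → ℕ) : Prop :=
  ∀ ⦃a b⦄, G.Adj a b → a ≠ b → r a < r b

lemma IsDAG.exists_isLayering [Finite V] (hG : IsDAG G) : ∃ r, IsLayering G r := by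
  let ancestors (v : V) : Set V := {u | Relation.TransGen (fun i j ↦ i ≠ j ∧ G.Adj i j) u v}
  refine ⟨fun v ↦ (ancestors v).ncard, fun a b hab hne ↦ Set.ncard_lt_ncard ?_ (Set.toFinite _)⟩
  rw [Set.ssubset_iff_of_subset fun u hu ↦ hu.tail ⟨hne, hab⟩]
  exact ⟨a, .single ⟨hne, hab⟩, hG.acyclic a⟩

lemma IsLayering.isDAG (hr : IsLayering G r) (hloop : ∀ v, G.Adj v v) : IsDAG G where
  loop := hloop
  acyclic v hv := by
    have hlt : Relation.TransGen (· < ·) (r v) (r v) := hv.lift r fun a b h ↦ hr h.2 h.1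
    rw [Relation.transGen_eq_self] at hlt
    exact hlt.false

lemma IsDAG.antisymm (hG : IsDAG G) (hab : G.Adj a b) (hba : G.Adj b a) : a = b := by
  by_contra hne
  exact hG.acyclic a (.tail (.single ⟨hne, hab⟩) ⟨Ne.symm hne, hba⟩)

lemma IsDAG.eq_of_triangle (hG : IsDAG G) (hab : G.Adj a b) (hbc : G.Adj b c) (hca : G.Adj c a) :
    a = b := by
  by_contra hne
  obtain rfl | hbc' := eq_or_ne b c
  · exact hne (hG.antisymm hab hca)
  obtain rfl | hca' := eq_or_ne c a
  · exact hne (hG.antisymm hab hbc)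
  exact hG.acyclic a (.tail (.tail (.single ⟨hne, hab⟩) ⟨hbc', hbc⟩) ⟨hca', hca⟩)

end Layering

section Stability

section

open scoped ComplexOrder MatrixOrder

lemma posDef_map_ofReal {n : Type*} [Finite n] {S : Matrix n n ℝ} (hS : S.PosDef) :
    (S.map Complex.ofReal).PosDef := by
  classical
  have := Fintype.ofFinite n
  obtain ⟨B, hB, rfl⟩ :=
    CStarAlgebra.isStrictlyPositive_iff_eq_star_mul_self.1 (isStrictlyPositive_iff_posDef.2 hS)
  have hmap : (star B * B).map Complex.ofReal =
      star (B.map Complex.ofReal) * 1 * B.map Complex.ofReal := by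
    ext i j
    simp [mul_apply, star_apply]
  rw [hmap]
  exact (IsUnit.posDef_star_left_conjugate_iff (hB.map Complex.ofRealHom.mapMatrix)).2 .one

end

variable {𝕜 n : Type*} [Fintype n] [DecidableEq n]

lemma exists_left_eigenvector [Field 𝕜] {M : Matrix n n 𝕜} {z : 𝕜} (hz : z ∈ spectrum 𝕜 M) :
    ∃ v ≠ 0, v ᵥ* M = z • v := by
  rw [spectrum.mem_iff, isUnit_iff_isUnit_det, isUnit_iff_ne_zero, not_not] at hz
  obtain ⟨v, hv, hvM⟩ := exists_vecMul_eq_zero_iff.2 hz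
  refine ⟨v, hv, ?_⟩
  rw [vecMul_sub, sub_eq_zero, Algebra.algebraMap_eq_smul_one, vecMul_smul, vecMul_one] at hvM
  exact hvM.symm

section

open scoped ComplexOrder

lemma re_neg_of_lyapunov [RCLike 𝕜] {M S C : Matrix n n 𝕜} (hS : S.PosDef) (hC : C.PosDef)
    (h : M * S + S * Mᴴ + C = 0) {z : 𝕜} (hz : z ∈ spectrum 𝕜 M) : RCLike.re z < 0 := by
  obtain ⟨v, hv, hvM⟩ := exists_left_eigenvector hz
  have hMv : Mᴴ *ᵥ star v = star z • star v := by rw [← star_vecMul, hvM, star_smul]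
  have hquad : (z + star z) * (v ⬝ᵥ S *ᵥ star v) + v ⬝ᵥ C *ᵥ star v = 0 := by
    simpa only [add_mulVec, dotProduct_add, ← mulVec_mulVec, hMv, mulVec_smul, dotProduct_smul,
      dotProduct_mulVec v M, hvM, smul_dotProduct, zero_mulVec, dotProduct_zero, smul_eq_mul,
      ← add_mul] using congrArg (fun X ↦ v ⬝ᵥ X *ᵥ star v) h
  have hre : (RCLike.re z + RCLike.re z) * RCLike.re (v ⬝ᵥ S *ᵥ star v) +
      RCLike.re (v ⬝ᵥ C *ᵥ star v) = 0 := by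
    simpa using congrArg RCLike.re hquad
  have hS' := hS.re_dotProduct_pos (star_ne_zero.2 hv)
  have hC' := hC.re_dotProduct_pos (star_ne_zero.2 hv)
  rw [star_star] at hS' hC'
  nlinarith

lemma isStable_of_lyapunov {M S C : Matrix n n ℝ} (hS : S.PosDef) (hC : C.PosDef)
    (h : M * S + S * Mᵀ + C = 0) : IsStable M := by
  intro z hz
  refine re_neg_of_lyapunov (posDef_map_ofReal hS) (posDef_map_ofReal hC) ?_ hz
  ext i j
  simpa [mul_apply] using congrArg Complex.ofReal (congrFun₂ h i j)

end

lemma mem_modelWith_iff {G : Digraph n} {C S : Matrix n n ℝ} (hC : C.PosDef) :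
    S ∈ modelWith G C ↔ S.PosDef ∧ ∃ M ∈ sparse G, M * S + S * Mᵀ + C = 0 :=
  ⟨fun ⟨hS, M, hM, _, h⟩ ↦ ⟨hS, M, hM, h⟩,
    fun ⟨hS, M, hM, h⟩ ↦ ⟨hS, M, hM, isStable_of_lyapunov hS hC h, h⟩⟩

lemma mem_model_iff {G : Digraph n} {S : Matrix n n ℝ} :
    S ∈ model G ↔
      S.PosDef ∧ ∃ M ∈ sparse G, M * S + S * Mᵀ + (2 : ℝ) • (1 : Matrix n n ℝ) = 0 :=
  mem_modelWith_iff (PosDef.one.smul two_pos)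

variable {G : Digraph n} {r : n → ℕ} {M : Matrix n n ℝ}

lemma charpoly_eq_prod_diag (hr : IsLayering G r) (hM : M ∈ sparse G) :
    M.charpoly = ∏ i, (.X - .C (M i i)) := by
  have hzero : ∀ a b, r a ≤ r b → a ≠ b → M a b = 0 := fun a b hab hne ↦
    hM b a fun h ↦ (hr h hne.symm).not_ge hab
  have htri : BlockTriangular Mᵀ r := fun a b hab ↦ hzero b a hab.le fun h ↦ hab.ne (h ▸ rfl)
  have hblock (k : ℕ) : Mᵀ.toSquareBlock r k = diagonal fun i : {v // r v = k} ↦ M i i := by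
    ext i j
    obtain rfl | hij := eq_or_ne i j
    · simp [toSquareBlock_def]
    · rw [diagonal_apply_ne _ hij]
      exact hzero j i (j.2.trans i.2.symm).le fun h ↦ hij (Subtype.ext h.symm)
  rw [← charpoly_transpose, htri.charpoly]
  simp only [hblock, charpoly_diagonal]
  rw [← Finset.prod_fiberwise_of_maps_to (g := r) fun i hi ↦ Finset.mem_image_of_mem r hi]
  refine Finset.prod_congr rfl fun k _ ↦ ?_
  exact (Finset.prod_subtype {i | r i = k} (fun i ↦ by simp)
    fun i ↦ Polynomial.X - Polynomial.C (M i i)).symm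

lemma diag_mem_spectrum (hr : IsLayering G r) (hM : M ∈ sparse G) (i : n) :
    (M i i : ℂ) ∈ spectrum ℂ (M.map Complex.ofReal) := by
  have hmap : (M.map Complex.ofReal).charpoly = M.charpoly.map Complex.ofRealHom :=
    charpoly_map M Complex.ofRealHom
  rw [mem_spectrum_iff_isRoot_charpoly, hmap, charpoly_eq_prod_diag hr hM, Polynomial.IsRoot,
    Polynomial.eval_map, Polynomial.eval₂_finsetProd]
  exact Finset.prod_eq_zero (Finset.mem_univ i) (by simp)

lemma diag_neg_of_isStable (hr : IsLayering G r) (hM : M ∈ sparse G) (hst : IsStable M) (i : n) :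
    M i i < 0 := by
  simpa using hst _ (diag_mem_spectrum hr hM i)

end Stability

section Comap

variable {V W U : Type*}

/-- The pullback of a digraph along a map of vertex sets; `induce G K` is the pullback along the
inclusion of `K`. -/
def comap (G : Digraph V) (f : W → V) : Digraph W where
  Adj a b := G.Adj (f a) (f b)

lemma posDef_fromBlocks [Finite W] [Finite U] {A : Matrix W W ℝ} {D : Matrix U U ℝ}
    (hA : A.PosDef) (hD : D.PosDef) : (fromBlocks A 0 0 D).PosDef := by
  have := Fintype.ofFinite W
  have := Fintype.ofFinite U
  refine .of_dotProduct_mulVec_pos (hA.isHermitian.fromBlocks (by simp) hD.isHermitian)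
    fun x hx ↦ ?_
  obtain ⟨u, v, rfl⟩ : ∃ u v, x = Sum.elim u v := ⟨_, _, (Sum.elim_comp_inl_inr x).symm⟩
  have hsum : star (Sum.elim u v) ⬝ᵥ fromBlocks A 0 0 D *ᵥ Sum.elim u v =
      star u ⬝ᵥ A *ᵥ u + star v ⬝ᵥ D *ᵥ v := by
    simp [fromBlocks_mulVec, dotProduct]
  rw [hsum]
  obtain hu | hu := eq_or_ne u 0
  · have hv : v ≠ 0 := fun hv ↦ hx (by simp [hu, hv])
    exact add_pos_of_nonneg_of_pos (hA.posSemidef.dotProduct_mulVec_nonneg u)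
      (hD.dotProduct_mulVec_pos hv)
  · exact add_pos_of_pos_of_nonneg (hA.dotProduct_mulVec_pos hu)
      (hD.posSemidef.dotProduct_mulVec_nonneg v)

variable [Fintype V] [DecidableEq V] [Fintype W] [DecidableEq W] [Fintype U] [DecidableEq U]

lemma fromBlocks_mem_model_iff {G : Digraph (W ⊕ U)} (hloop : ∀ v, G.Adj v v) {S : Matrix W W ℝ} :
    fromBlocks S 0 0 1 ∈ model G ↔ S ∈ model (comap G Sum.inl) := by
  simp only [mem_model_iff]
  constructor
  · rintro ⟨hS, M, hM, h⟩
    refine ⟨hS.submatrix Sum.inl_injective, M.toBlocks₁₁, fun a b hab ↦ hM _ _ hab, ?_⟩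
    rw [← fromBlocks_toBlocks M] at h
    simp only [← fromBlocks_one, fromBlocks_transpose, fromBlocks_multiply, fromBlocks_smul,
      fromBlocks_add] at h
    rw [← fromBlocks_zero] at h
    simpa only [Matrix.mul_zero, Matrix.zero_mul, add_zero] using (fromBlocks_inj.1 h).1
  · rintro ⟨hS, M, hM, h⟩
    refine ⟨posDef_fromBlocks hS .one, fromBlocks M 0 0 (-1), ?_, ?_⟩
    · rintro (a | a) (b | b) hab
      · exact hM a b hab
      · rfl
      · rfl
      · have hne : b ≠ a := fun h ↦ hab (h ▸ hloop _)
        simp [hne]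
    · have hU : (-1 + -1 + (2 : ℝ) • 1 : Matrix U U ℝ) = 0 := by module
      simp only [← fromBlocks_one, fromBlocks_transpose, fromBlocks_multiply, fromBlocks_smul,
        fromBlocks_add]
      simp [h, hU]

lemma submatrix_mem_model {G : Digraph V} {S : Matrix V V ℝ} (hS : S ∈ model G) (e : W ≃ V) :
    S.submatrix e e ∈ model (comap G e) := by
  obtain ⟨hS, M, hM, h⟩ := mem_model_iff.1 hS
  refine mem_model_iff.2 ⟨hS.submatrix e.injective, M.submatrix e e, fun a b hab ↦ hM _ _ hab, ?_⟩
  simpa [submatrix_mul_equiv, submatrix_add, submatrix_smul] using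
    congrArg (fun X ↦ X.submatrix e e) h

lemma mem_model_comap_equiv {G : Digraph V} {S : Matrix W W ℝ} (e : W ≃ V) :
    S ∈ model (comap G e) ↔ S.submatrix e.symm e.symm ∈ model G := by
  refine ⟨fun hS ↦ ?_, fun hS ↦ by simpa using submatrix_mem_model hS e⟩
  simpa [comap] using submatrix_mem_model hS e.symm

theorem ModelEquiv.comap {G₁ G₂ : Digraph V} (h₁ : ∀ v, G₁.Adj v v) (h₂ : ∀ v, G₂.Adj v v)
    {f : W → V} (hf : f.Injective) (h : ModelEquiv G₁ G₂) :
    ModelEquiv (comap G₁ f) (comap G₂ f) := by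
  classical
  let e : W ⊕ ↑(Set.range f)ᶜ ≃ V :=
    (Equiv.sumCongr (.ofInjective f hf) (.refl _)).trans (Equiv.Set.sumCompl _)
  have key {G : Digraph V} (hloop : ∀ v, G.Adj v v) (S : Matrix W W ℝ) :
      S ∈ model (Lyapunov.comap G f) ↔
        (fromBlocks S 0 0 1).submatrix e.symm e.symm ∈ model G := by
    rw [← mem_model_comap_equiv, fromBlocks_mem_model_iff fun v ↦ hloop (e v)]
    rfl
  ext S
  rw [key h₁, key h₂, h]

end Comap

section Trade

variable {V : Type*}

/-- A set of vertices that is closed under passing to parents. -/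
def IsAncestral (G : Digraph V) (A : Set V) : Prop :=
  ∀ ⦃a b⦄, G.Adj a b → b ∈ A → a ∈ A

/-- The graph `G` with the edge `i → j` replaced by `j → i`. -/
def reverseEdge (G : Digraph V) (i j : V) : Digraph V where
  Adj a b := G.Adj a b ∧ ¬ (a = i ∧ b = j) ∨ a = j ∧ b = i

/-- Disjoint ancestral sets `A` and `B` certify that reversing the edge `i → j` does not change the
Lyapunov model of `G`: the set `A` contains `i` and `j`, and each vertex of `A` has an edge to `i`,
to `j` and to every vertex outside `A ∪ B`, except that `j → i` is not required. -/
structure IsReversalCertificate (G : Digraph V) (i j : V) (A B : Set V) : Prop where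
  left : IsAncestral G A
  right : IsAncestral G B
  disjoint : Disjoint A B
  source_mem : i ∈ A
  target_mem : j ∈ A
  adj : ∀ ⦃s⦄, s ∈ A → ∀ ⦃k⦄, k ∉ B → (k ∈ A → k = i ∨ k = j) → ¬ (s = j ∧ k = i) → G.Adj s k

variable {G : Digraph V} {i j : V} {A B : Set V}

lemma reverseEdge_reverseEdge (hne : i ≠ j) (hij : G.Adj i j) (hji : ¬ G.Adj j i) :
    reverseEdge (reverseEdge G i j) j i = G := by
  ext a b
  simp only [reverseEdge]
  grind

namespace IsReversalCertificate

lemma adj_edge (h : IsReversalCertificate G i j A B) (hne : i ≠ j) : G.Adj i j :=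
  h.adj h.source_mem (h.disjoint.notMem_of_mem_left h.target_mem) (fun _ ↦ .inr rfl)
    fun h ↦ hne h.1

lemma reverseEdge (h : IsReversalCertificate G i j A B) (hne : i ≠ j) :
    IsReversalCertificate (reverseEdge G i j) j i A B where
  left := by
    rintro a b (⟨hab, -⟩ | ⟨rfl, -⟩) hb
    · exact h.left hab hb
    · exact h.target_mem
  right := by
    rintro a b (⟨hab, -⟩ | ⟨-, rfl⟩) hb
    · exact h.right hab hb
    · exact absurd hb (h.disjoint.notMem_of_mem_left h.source_mem)
  disjoint := h.disjoint
  source_mem := h.target_mem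
  target_mem := h.source_mem
  adj s hs k hk hkA hsk := by
    by_cases hji : s = j ∧ k = i
    · exact .inr hji
    · exact .inl ⟨h.adj hs hk (fun hk ↦ (hkA hk).symm) hji, hsk⟩

lemma isDAG_reverseEdge [Finite V] (h : IsReversalCertificate G i j A B) (hG : IsDAG G)
    (hne : i ≠ j) : IsDAG (Lyapunov.reverseEdge G i j) := by
  classical
  obtain ⟨r, hr⟩ := hG.exists_isLayering
  -- `i` moves to a new layer just above that of `j`.
  suffices IsLayering (Lyapunov.reverseEdge G i j)
      (Function.update (fun v ↦ 2 * r v) i (2 * r j + 1)) from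
    this.isDAG fun v ↦ .inl ⟨hG.loop v, fun h ↦ hne (h.1.symm.trans h.2)⟩
  have parent {a : V} (ha : G.Adj a i) (hai : a ≠ i) : r a < r j := by
    have haj : G.Adj a j := h.adj (h.left ha h.source_mem)
      (h.disjoint.notMem_of_mem_left h.target_mem) (fun _ ↦ .inr rfl) fun h ↦ hne h.2.symm
    exact hr haj fun haj ↦ hai (hG.antisymm ha (haj ▸ h.adj_edge hne))
  have child {b : V} (hb : G.Adj i b) (hbi : b ≠ i) (hbj : b ≠ j) : r j < r b := by
    have hbA : b ∉ A := fun hbA ↦ hbi <| hG.antisymm (h.adj hbA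
      (h.disjoint.notMem_of_mem_left h.source_mem) (fun _ ↦ .inl rfl) fun h ↦ hbj h.1) hb
    have hbB : b ∉ B := fun hbB ↦ h.disjoint.notMem_of_mem_left h.source_mem (h.right hb hbB)
    exact hr (h.adj h.target_mem hbB (fun hb ↦ absurd hb hbA) fun h ↦ hbi h.2) hbj.symm
  rintro a b (⟨hab, hn⟩ | ⟨rfl, rfl⟩) hne'
  · obtain rfl | hai := eq_or_ne a i
    · have := child hab hne'.symm fun hb ↦ hn ⟨rfl, hb⟩
      simp only [Function.update_self, Function.update_of_ne hne'.symm]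
      omega
    obtain rfl | hbi := eq_or_ne b i
    · have := parent hab hai
      simp only [Function.update_self, Function.update_of_ne hne']
      omega
    · have := hr hab hne'
      simp only [Function.update_of_ne hai, Function.update_of_ne hbi]
      omega
  · simp only [Function.update_self, Function.update_of_ne hne']
    omega

end IsReversalCertificate

variable [Fintype V] [DecidableEq V] {M S : Matrix V V ℝ} {c : V → ℝ}

lemma exists_principal_inverse_column (hS : S.PosDef) (hi : i ∈ A) :
    ∃ x : V → ℝ, (∀ v ∉ A, x v = 0) ∧ (∀ s ∈ A, (S *ᵥ x) s = if s = i then 1 else 0) ∧ 0 < x i := by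
  classical
  let P : Matrix A A ℝ := S.submatrix (↑) (↑)
  have hP : P.PosDef := hS.submatrix Subtype.val_injective
  refine ⟨fun v ↦ if h : v ∈ A then P⁻¹ ⟨v, h⟩ ⟨i, hi⟩ else 0, fun v hv ↦ dif_neg hv,
    fun s hs ↦ ?_, by simpa [hi] using hP.inv.diag_pos (i := ⟨i, hi⟩)⟩
  have hinv : (P * P⁻¹) ⟨s, hs⟩ ⟨i, hi⟩ = if s = i then 1 else 0 := by
    rw [mul_nonsing_inv _ ((isUnit_iff_isUnit_det _).1 hP.isUnit), one_apply]
    simp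
  rw [← hinv]
  simp only [mulVec, dotProduct, mul_apply]
  exact Finset.sum_congr_set A _ _ (fun v hv ↦ by simp [hv, P]) fun v hv ↦ by simp [hv]

lemma covariance_eq_zero {r : V → ℕ} (hr : IsLayering G r) (hM : M ∈ sparse G) (hst : IsStable M)
    (h : M * S + S * Mᵀ + diagonal c = 0) (hA : IsAncestral G A) (hB : IsAncestral G B)
    (hAB : Disjoint A B) {a b : V} (ha : a ∈ A) (hb : b ∈ B) : S b a = 0 := by
  induction hn : r b + r a using Nat.strong_induction_on generalizing a b with
  | _ n ih =>
  have hba : b ≠ a := fun hba ↦ hAB.notMem_of_mem_left ha (hba ▸ hb)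
  have hentry : ∑ k, M b k * S k a + ∑ k, S b k * M a k = 0 := by
    simpa [mul_apply, hba] using congrFun₂ h b a
  rw [Finset.sum_eq_single_of_mem b (Finset.mem_univ b) fun k _ hk ↦ ?left,
    Finset.sum_eq_single_of_mem a (Finset.mem_univ a) fun k _ hk ↦ ?right] at hentry
  · have hMb := diag_neg_of_isStable hr hM hst b
    have hMa := diag_neg_of_isStable hr hM hst a
    have hprod : (M b b + M a a) * S b a = 0 := by linarith
    exact (mul_eq_zero.1 hprod).resolve_left (by linarith)
  case left =>
    by_cases hkb : G.Adj k b
    · rw [ih _ (hn ▸ Nat.add_lt_add_right (hr hkb hk) _) ha (hB hkb hb) rfl, mul_zero]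
    · rw [hM _ _ hkb, zero_mul]
  case right =>
    by_cases hka : G.Adj k a
    · rw [ih _ (hn ▸ Nat.add_lt_add_left (hr hka hk) _) (hA hka ha) hb rfl, zero_mul]
    · rw [hM _ _ hka, mul_zero]

omit [DecidableEq V] in
lemma vecMulVec_sub_vecMulVec_lyapunov (hS : Sᵀ = S) (x y : V → ℝ) :
    (vecMulVec (S *ᵥ x) y - vecMulVec (S *ᵥ y) x) * S +
      S * (vecMulVec (S *ᵥ x) y - vecMulVec (S *ᵥ y) x)ᵀ = 0 := by
  have hvec (u : V → ℝ) : u ᵥ* S = S *ᵥ u := by rw [← mulVec_transpose, hS]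
  simp only [Matrix.sub_mul, Matrix.mul_sub, transpose_sub, transpose_vecMulVec, vecMulVec_mul,
    mul_vecMulVec, hvec]
  abel

namespace IsReversalCertificate

lemma exists_lyapunov_kernel (h : IsReversalCertificate G i j A B) (hG : IsDAG G) (hne : i ≠ j)
    (hS : S ∈ modelWith G (diagonal c)) :
    ∃ D : Matrix V V ℝ, D * S + S * Dᵀ = 0 ∧ D j i ≠ 0 ∧
      ∀ s k, ¬ G.Adj s k → ¬ (s = j ∧ k = i) → D k s = 0 := by
  obtain ⟨hS, M, hM, hst, hlyap⟩ := hS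
  obtain ⟨r, hr⟩ := hG.exists_isLayering
  obtain ⟨x, hx, hSx, hxi⟩ := exists_principal_inverse_column hS h.source_mem
  obtain ⟨y, hy, hSy, -⟩ := exists_principal_inverse_column hS h.target_mem
  have hSB {u : V → ℝ} (hu : ∀ v ∉ A, u v = 0) {b : V} (hb : b ∈ B) : (S *ᵥ u) b = 0 := by
    refine Finset.sum_eq_zero fun v _ ↦ ?_
    by_cases hv : v ∈ A
    · simp [covariance_eq_zero hr hM hst hlyap h.left h.right h.disjoint hv hb]
    · simp [hu v hv]
  refine ⟨vecMulVec (S *ᵥ x) y - vecMulVec (S *ᵥ y) x,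
    vecMulVec_sub_vecMulVec_lyapunov (by simpa using hS.isHermitian.eq) x y, ?_,
    fun s k hsk hji ↦ ?_⟩
  · simp [vecMulVec_apply, hSx j h.target_mem, hSy j h.target_mem, hne.symm, hxi.ne']
  · rw [Matrix.sub_apply, vecMulVec_apply, vecMulVec_apply]
    by_cases hs : s ∈ A
    · by_cases hk : k ∈ B
      · simp [hSB hx hk, hSB hy hk]
      · have hkA : k ∈ A ∧ k ≠ i ∧ k ≠ j := by
          by_contra! hkA
          exact hsk (h.adj hs hk (fun hk ↦ or_iff_not_imp_left.2 (hkA hk)) hji)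
        simp [hSx k hkA.1, hSy k hkA.1, hkA.2]
    · simp [hx s hs, hy s hs]

lemma modelWith_subset (h : IsReversalCertificate G i j A B) (hG : IsDAG G) (hne : i ≠ j)
    (hc : ∀ v, 0 < c v) :
    modelWith G (diagonal c) ⊆ modelWith (Lyapunov.reverseEdge G i j) (diagonal c) := by
  intro S hS
  obtain ⟨D, hDS, hDji, hD⟩ := h.exists_lyapunov_kernel hG hne hS
  obtain ⟨hS, M, hM, -, hlyap⟩ := hS
  let t := M j i / D j i
  refine (mem_modelWith_iff (.diagonal hc)).2 ⟨hS, M - t • D, fun s k hsk ↦ ?_, ?_⟩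
  · rw [Matrix.sub_apply, Matrix.smul_apply, smul_eq_mul]
    by_cases hij : s = i ∧ k = j
    · obtain ⟨rfl, rfl⟩ := hij
      rw [div_mul_cancel₀ _ hDji, sub_self]
    · have hGsk : ¬ G.Adj s k := fun h ↦ hsk (.inl ⟨h, hij⟩)
      rw [hM s k hGsk, hD s k hGsk fun h ↦ hsk (.inr h), mul_zero, sub_zero]
  · calc (M - t • D) * S + S * (M - t • D)ᵀ + diagonal c
        = (M * S + S * Mᵀ + diagonal c) - t • (D * S + S * Dᵀ) := by
          simp only [Matrix.sub_mul, Matrix.mul_sub, transpose_sub, transpose_smul,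
            Matrix.smul_mul, Matrix.mul_smul]
          module
      _ = 0 := by rw [hlyap, hDS, smul_zero, sub_zero]

theorem model_reverseEdge (h : IsReversalCertificate G i j A B) (hG : IsDAG G) (hne : i ≠ j) :
    model (Lyapunov.reverseEdge G i j) = model G := by
  have hij := h.adj_edge hne
  have hback := (h.reverseEdge hne).modelWith_subset (c := fun _ ↦ 2) (h.isDAG_reverseEdge hG hne)
    hne.symm fun _ ↦ two_pos
  rw [reverseEdge_reverseEdge hne hij fun hji ↦ hne (hG.antisymm hij hji)] at hback
  simp only [model, smul_one_eq_diagonal]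
  exact hback.antisymm (h.modelWith_subset hG hne fun _ ↦ two_pos)

end IsReversalCertificate

end Trade

section Reversible

variable {V : Type*} {G G₁ G₂ : Digraph V} {i j a b : V}

/-- Two vertices are linked if an edge joins them in some direction. In a graph with all self-loops
every vertex is thus linked to itself. -/
def Linked (G : Digraph V) (a b : V) : Prop :=
  G.Adj a b ∨ G.Adj b a

lemma Linked.symm (h : Linked G a b) : Linked G b a :=
  Or.symm h

/-- The local conditions on an edge `i → j` under which it can be reversed: `i` and `j` have the
same neighbours, every neighbour of a parent of `i` and every child of a child of `i` is a neighbour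
of `i`, and every parent of `i` is a neighbour of every child of `i`. -/
structure IsReversible (G : Digraph V) (i j : V) : Prop where
  twin : ∀ p, Linked G p i ↔ Linked G p j
  parent : ∀ ⦃p q⦄, G.Adj p i → Linked G p q → Linked G q i
  child : ∀ ⦃k l⦄, G.Adj i k → G.Adj k l → Linked G l i
  through : ∀ ⦃p k⦄, G.Adj p i → G.Adj i k → Linked G p k

lemma linked_reverseEdge (hij : G.Adj i j) : Linked (reverseEdge G i j) a b ↔ Linked G a b := by
  simp only [Linked, reverseEdge]
  grind

lemma IsReversible.reverseEdge (h : IsReversible G i j) (hij : G.Adj i j)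
    (hab : IsReversible G a b) : IsReversible (reverseEdge G i j) a b where
  twin p := by simpa only [linked_reverseEdge hij] using hab.twin p
  parent p q hp hpq := by
    rw [linked_reverseEdge hij] at hpq ⊢
    obtain ⟨hp, -⟩ | ⟨rfl, rfl⟩ := hp
    · exact hab.parent hp hpq
    · exact (h.twin q).2 hpq.symm
  child k l hk hl := by
    rw [linked_reverseEdge hij]
    obtain ⟨hk, -⟩ | ⟨rfl, rfl⟩ := hk
    · obtain ⟨hl, -⟩ | ⟨rfl, rfl⟩ := hl
      · exact hab.child hk hl
      · exact ((h.twin a).2 (.inl hk)).symm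
    · exact (h.twin l).1 (((linked_reverseEdge hij).1 (.inl hl)).symm)
  through p k hp hk := by
    rw [linked_reverseEdge hij]
    obtain ⟨hp, -⟩ | ⟨rfl, rfl⟩ := hp
    · obtain ⟨hk, -⟩ | ⟨rfl, rfl⟩ := hk
      · exact hab.through hp hk
      · exact (h.twin p).2 (.inl hp)
    · exact ((h.twin k).1 ((linked_reverseEdge hij).1 (.inl hk)).symm).symm

lemma IsReversible.isAncestral (h : IsReversible G i j) (hG : IsDAG G)
    (hbetween : ∀ l, G.Adj i l → G.Adj l j → l = i ∨ l = j) :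
    IsAncestral G {p | G.Adj p i ∨ p = j} := by
  rintro a s has (hs | rfl)
  · obtain hai | hia := h.parent hs (.inr has)
    · exact .inl hai
    · exact .inl (hG.eq_of_triangle hia has hs ▸ hG.loop i)
  · obtain hai | hia := (h.twin a).2 (.inl has)
    · exact .inl hai
    · obtain rfl | rfl := hbetween a hia has
      · exact .inl (hG.loop a)
      · exact .inr rfl

lemma IsReversible.isReversalCertificate (h : IsReversible G i j) (hG : IsDAG G) (hne : i ≠ j)
    (hij : G.Adj i j) (hbetween : ∀ l, G.Adj i l → G.Adj l j → l = i ∨ l = j) :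
    IsReversalCertificate G i j {p | G.Adj p i ∨ p = j} {v | ¬ Linked G v i} where
  left := h.isAncestral hG hbetween
  right a b hab hb ha := by
    obtain hai | hia := ha
    · exact hb (h.parent hai (.inl hab))
    · exact hb (h.child hia hab)
  disjoint := by
    refine Set.disjoint_left.2 fun v hv hvi ↦ hvi ?_
    obtain hv | rfl := hv
    · exact .inl hv
    · exact .inr hij
  source_mem := .inl (hG.loop i)
  target_mem := .inr rfl
  adj s hs k hk hkA hsk := by
    by_cases hkA' : G.Adj k i ∨ k = j
    · obtain rfl | rfl := hkA hkA'
      · exact hs.resolve_right fun hs ↦ hsk ⟨hs, rfl⟩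
      · obtain hs | rfl := hs
        · exact ((h.twin s).1 (.inl hs)).resolve_right fun hks ↦
            hne (hG.eq_of_triangle hij hks hs)
        · exact hG.loop s
    · have hki : Linked G k i := not_not.1 hk
      have hlink : Linked G s k := by
        obtain hs | rfl := hs
        · exact h.through hs (hki.resolve_left fun hki ↦ hkA' (.inl hki))
        · exact ((h.twin k).1 hki).symm
      exact hlink.resolve_right fun hks ↦ hkA' (h.isAncestral hG hbetween hks hs)

/-- The edges of `G₁`, other than the self-loops, whose reversals are edges of `G₂`. -/
def reversedEdges (G₁ G₂ : Digraph V) : Set (V × V) :=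
  {e | e.1 ≠ e.2 ∧ G₁.Adj e.1 e.2 ∧ G₂.Adj e.2 e.1}

lemma reversedEdges_reverseEdge (hG₂ : IsDAG G₂) (h : (i, j) ∈ reversedEdges G₁ G₂) :
    reversedEdges (reverseEdge G₁ i j) G₂ = reversedEdges G₁ G₂ \ {(i, j)} := by
  ext ⟨a, b⟩
  have hij : ¬ G₂.Adj i j := fun hij ↦ h.1 (hG₂.antisymm hij h.2.2)
  simp only [reversedEdges, reverseEdge, Set.mem_ofPred_eq, Set.mem_sdiff, Set.mem_singleton_iff,
    Prod.mk.injEq]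
  grind

lemma eq_of_reversedEdges_eq_empty (hG₁ : IsDAG G₁) (hG₂ : IsDAG G₂)
    (hlink : ∀ a b, Linked G₁ a b ↔ Linked G₂ a b) (h : reversedEdges G₁ G₂ = ∅) : G₁ = G₂ := by
  have hrev {a b : V} (hne : a ≠ b) (hab : G₁.Adj a b) : ¬ G₂.Adj b a := fun hba ↦
    Set.notMem_empty (a, b) (h ▸ ⟨hne, hab, hba⟩)
  ext a b
  obtain rfl | hne := eq_or_ne a b
  · exact iff_of_true (hG₁.loop a) (hG₂.loop a)
  · exact ⟨fun hab ↦ ((hlink a b).1 (.inl hab)).resolve_right (hrev hne hab),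
      fun hab ↦ ((hlink a b).2 (.inl hab)).resolve_right fun hba ↦ hrev hne.symm hba hab⟩

lemma exists_mem_reversedEdges_no_between [Finite V] (hG₁ : IsDAG G₁) (hG₂ : IsDAG G₂)
    (hlink : ∀ a b, Linked G₁ a b ↔ Linked G₂ a b) (h : (reversedEdges G₁ G₂).Nonempty) :
    ∃ i j, (i, j) ∈ reversedEdges G₁ G₂ ∧ ∀ l, G₁.Adj i l → G₁.Adj l j → l = i ∨ l = j := by
  obtain ⟨r, hr⟩ := hG₁.exists_isLayering
  obtain ⟨⟨i, j⟩, ⟨hne, hij, hji⟩, hmin⟩ :=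
    exists_minimalFor_of_wellFoundedLT (· ∈ reversedEdges G₁ G₂) (fun e ↦ r e.2 - r e.1) h
  refine ⟨i, j, ⟨hne, hij, hji⟩, fun l hil hlj ↦ ?_⟩
  by_contra! hl
  have hri := hr hil hl.1.symm
  have hrj := hr hlj hl.2
  obtain hil' | hli' := (hlink i l).1 (.inl hil)
  · obtain hlj' | hjl' := (hlink l j).1 (.inl hlj)
    · exact hne (hG₂.eq_of_triangle hji hil' hlj').symm
    · have := hmin (j := (l, j)) ⟨hl.2, hlj, hjl'⟩
      grind
  · have := hmin (j := (i, l)) ⟨hl.1.symm, hil, hli'⟩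
    grind

theorem modelEquiv_of_isReversible [Fintype V] [DecidableEq V] (hG₁ : IsDAG G₁) (hG₂ : IsDAG G₂)
    (hlink : ∀ a b, Linked G₁ a b ↔ Linked G₂ a b)
    (hrev : ∀ i j, (i, j) ∈ reversedEdges G₁ G₂ → IsReversible G₁ i j) : ModelEquiv G₁ G₂ := by
  induction hn : (reversedEdges G₁ G₂).ncard using Nat.strong_induction_on generalizing G₁ with
  | _ n ih =>
  obtain hempty | hnonempty := (reversedEdges G₁ G₂).eq_empty_or_nonempty
  · exact congrArg model (eq_of_reversedEdges_eq_empty hG₁ hG₂ hlink hempty)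
  obtain ⟨i, j, hmem, hbetween⟩ := exists_mem_reversedEdges_no_between hG₁ hG₂ hlink hnonempty
  obtain ⟨hne, hij, -⟩ := id hmem
  have hcert := (hrev i j hmem).isReversalCertificate hG₁ hne hij hbetween
  have hset := reversedEdges_reverseEdge hG₂ hmem
  refine (hcert.model_reverseEdge hG₁ hne).symm.trans <|
    ih _ ?_ (hcert.isDAG_reverseEdge hG₁ hne)
      (fun a b ↦ (linked_reverseEdge hij).trans (hlink a b)) (fun a b hab ↦ ?_) rfl
  · rw [hset, ← hn]
    exact Set.ncard_sdiff_singleton_lt_of_mem hmem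
  · exact (hrev i j hmem).reverseEdge hij (hrev a b (hset ▸ hab).1)

end Reversible

section Examples

variable {n : Type*} [Fintype n] [DecidableEq n] {G G₁ G₂ : Digraph n}

/-- The digraph with edge set `E` and all self-loops. -/
def ofEdges (E : Finset (n × n)) : Digraph n where
  Adj a b := a = b ∨ (a, b) ∈ E

instance (E : Finset (n × n)) : DecidableRel (ofEdges E).Adj := fun a b ↦
  inferInstanceAs (Decidable (a = b ∨ (a, b) ∈ E))

lemma posDef_of_sum_abs_lt_diag {S : Matrix n n ℝ} (hS : S.IsSymm)
    (h : ∀ i, ∑ j ∈ Finset.univ.erase i, |S i j| < S i i) : S.PosDef := by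
  have hHerm : S.IsHermitian := by rw [IsHermitian, conjTranspose_eq_transpose_of_trivial, hS]
  refine hHerm.posDef_iff_eigenvalues_pos.2 fun k ↦ ?_
  have heig : Module.End.HasEigenvalue S.toLin' (hHerm.eigenvalues k) := by
    rw [Module.End.hasEigenvalue_iff_mem_spectrum, spectrum_toLin']
    exact hHerm.eigenvalues_mem_spectrum_real k
  obtain ⟨i, hi⟩ := eigenvalue_mem_ball heig
  rw [Metric.mem_closedBall, Real.dist_eq] at hi
  simp only [Real.norm_eq_abs] at hi
  linarith [neg_le_of_abs_le hi, h i]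

lemma notMem_model_of_dual {S Y : Matrix n n ℝ} (hS : S.IsSymm) (hY : Y.IsSymm)
    (hYS : ∀ a b, G.Adj a b → (Y * S) b a = 0) (htr : Y.trace ≠ 0) : S ∉ model G := by
  rintro ⟨-, M, hM, -, hlyap⟩
  -- Taking the trace against `Y` kills both terms of the Lyapunov equation that involve `M`.
  have hleft : (Y * (S * Mᵀ)).trace = 0 := by
    rw [← Matrix.mul_assoc]
    refine Finset.sum_eq_zero fun b _ ↦ (mul_apply ..).trans <| Finset.sum_eq_zero fun a _ ↦ ?_
    by_cases hab : G.Adj a b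
    · rw [hYS a b hab, zero_mul]
    · rw [transpose_apply, hM a b hab, mul_zero]
  have hright : (Y * (M * S)).trace = 0 := by
    rw [← trace_transpose, transpose_mul, transpose_mul, hS, hY, trace_mul_comm, hleft]
  have htrace : (Y * (M * S)).trace + (Y * (S * Mᵀ)).trace + 2 * Y.trace = 0 := by
    simpa [Matrix.mul_add] using congrArg (fun X ↦ (Y * X).trace) hlyap
  rw [hleft, hright, zero_add, zero_add] at htrace
  exact htr ((mul_eq_zero_iff_left two_ne_zero).1 htrace)

lemma ModelEquiv.symm (h : ModelEquiv G₁ G₂) : ModelEquiv G₂ G₁ :=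
  Eq.symm h

-- Scaling the drift matrix by `c` keeps the certificates integral, so that they can be decided.
theorem not_modelEquiv_of_separated (M S Y : Matrix n n ℤ) (c : ℤ) (hc : 0 < c := by decide)
    (hM : ∀ i j, ¬ G₁.Adj i j → M j i = 0 := by decide)
    (hlyap : M * S + S * Mᵀ = -(2 * c) • (1 : Matrix n n ℤ) := by decide)
    (hS : S.IsSymm := by decide)
    (hdom : ∀ i, ∑ j ∈ Finset.univ.erase i, |S i j| < S i i := by decide)
    (hY : Y.IsSymm := by decide) (hYS : ∀ a b, G₂.Adj a b → (Y * S) b a = 0 := by decide)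
    (htr : Y.trace ≠ 0 := by decide) : ¬ ModelEquiv G₁ G₂ := by
  let toReal (X : Matrix n n ℤ) : Matrix n n ℝ := X.map (Int.cast : ℤ → ℝ)
  have hSpos : (toReal S).PosDef := by
    refine posDef_of_sum_abs_lt_diag (hS.map _) fun i ↦ ?_
    simpa [toReal] using (Int.cast_lt (R := ℝ)).2 (hdom i)
  have hmem : toReal S ∈ model G₁ := by
    have hlyap' : toReal M * toReal S + toReal S * (toReal M)ᵀ = (-(2 * c) : ℝ) • 1 := by
      ext i j
      simpa [toReal, mul_apply, one_apply] using congrArg (Int.cast : ℤ → ℝ) (congrFun₂ hlyap i j)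
    refine mem_model_iff.2 ⟨hSpos, (c : ℝ)⁻¹ • toReal M, fun i j hij ↦ ?_, ?_⟩
    · simp [toReal, hM i j hij]
    · have hc' : (c : ℝ) ≠ 0 := by exact_mod_cast hc.ne'
      have hcancel : (c : ℝ)⁻¹ * -(2 * c) = -2 := by field_simp
      rw [transpose_smul, Matrix.smul_mul, Matrix.mul_smul, ← smul_add, hlyap', smul_smul, hcancel,
        neg_smul, neg_add_cancel]
  have hnotMem : toReal S ∉ model G₂ := by
    refine notMem_model_of_dual (Y := toReal Y) (hS.map _) (hY.map _) (fun a b hab ↦ ?_) ?_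
    · simpa [toReal, mul_apply] using congrArg (Int.cast : ℤ → ℝ) (hYS a b hab)
    · have htr' : (toReal Y).trace = (Y.trace : ℝ) := by simp [toReal, trace]
      rw [htr']
      exact_mod_cast htr
  exact fun h ↦ hnotMem (h ▸ hmem)

lemma not_modelEquiv_edge_empty :
    ¬ ModelEquiv (ofEdges {(0, 1)})
      (ofEdges (∅ : Finset (Fin 2 × Fin 2))) :=
  not_modelEquiv_of_separated
    (M := !![-1, 0; -1, -1])
    (S := !![2, -1; -1, 3])
    (Y := !![3, 6; 6, 2]) (c := 2)

lemma not_modelEquiv_collider_chain :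
    ¬ ModelEquiv (ofEdges {(0, 1), (2, 1)})
      (ofEdges ({(0, 1), (1, 2)} : Finset (Fin 3 × Fin 3))) :=
  not_modelEquiv_of_separated
    (M := !![-1, 0, 0; -2, -3, -3; 0, 0, -3])
    (S := !![6, -3, 0; -3, 5, -1; 0, -1, 2])
    (Y := !![1, 2, 21; 2, 4, 14; 21, 14, 7]) (c := 6)

lemma not_modelEquiv_chain_reversedChain :
    ¬ ModelEquiv (ofEdges {(0, 1), (1, 2)})
      (ofEdges ({(1, 0), (2, 1)} : Finset (Fin 3 × Fin 3))) :=
  not_modelEquiv_of_separated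
    (M := !![-3, 0, 0; 4, -5, 0; 0, 3, -6])
    (S := !![6, 3, 1; 3, 6, 2; 1, 2, 4])
    (Y := !![0, 4, -12; 4, -2, 0; -12, 0, 3]) (c := 18)

lemma not_modelEquiv_collider_fork :
    ¬ ModelEquiv (ofEdges {(0, 1), (2, 1)})
      (ofEdges ({(1, 0), (1, 2)} : Finset (Fin 3 × Fin 3))) :=
  not_modelEquiv_of_separated
    (M := !![-1, 0, 0; -1, -1, -1; 0, 0, -1])
    (S := !![2, -1, 0; -1, 4, -1; 0, -1, 2])
    (Y := !![1, 2, 7; 2, 1, 2; 7, 2, 1]) (c := 2)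

lemma not_modelEquiv_fork_chain :
    ¬ ModelEquiv (ofEdges {(1, 0), (1, 2)})
      (ofEdges ({(1, 0), (2, 1)} : Finset (Fin 3 × Fin 3))) :=
  not_modelEquiv_of_separated
    (M := !![-3, -2, 0; 0, -3, 0; 0, -2, -3])
    (S := !![11, -3, 2; -3, 9, -3; 2, -3, 11])
    (Y := !![10, -30, -100; -30, -9, 3; -100, 3, 19]) (c := 27)

lemma not_modelEquiv_triangle_sourceChild :
    ¬ ModelEquiv (ofEdges {(0, 1), (2, 0), (2, 1), (2, 3)})
      (ofEdges ({(1, 0), (2, 0), (2, 1), (2, 3)} : Finset (Fin 4 × Fin 4))) :=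
  not_modelEquiv_of_separated
    (M := !![-1, 0, -1, 0; -1, -2, -1, 0; 0, 0, -2, 0; 0, 0, -1, -1])
    (S := !![42, -11, -6, 6; -11, 25, -3, 1; -6, -3, 18, -6; 6, 1, -6, 42])
    (Y := !![0, 0, 0, 0; 0, 0, 6, 18; 0, 6, 2, 3; 0, 18, 3, 0]) (c := 36)

lemma not_modelEquiv_triangle_sourceParent :
    ¬ ModelEquiv (ofEdges {(0, 1), (2, 0), (2, 1), (3, 2)})
      (ofEdges ({(1, 0), (2, 0), (2, 1), (3, 2)} : Finset (Fin 4 × Fin 4))) :=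
  not_modelEquiv_of_separated
    (M := !![-1, 0, -1, 0; 3, -4, 3, 0; 0, 0, -2, 1; 0, 0, 0, -2])
    (S := !![173, 81, -29, -6; 81, 117, 27, 6; -29, 27, 81, 18; -6, 6, 18, 72])
    (Y := !![0, 0, 0, 0; 0, 0, 24, -108; 0, 24, -8, 0; 0, -108, 0, 9]) (c := 144)

lemma not_modelEquiv_triangle_sinkChild :
    ¬ ModelEquiv (ofEdges {(0, 1), (0, 2), (1, 2), (2, 3)})
      (ofEdges ({(1, 0), (0, 2), (1, 2), (2, 3)} : Finset (Fin 4 × Fin 4))) :=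
  not_modelEquiv_of_separated
    (M := !![-2, 0, 0, 0; -2, -2, 0, 0; -1, -2, -3, 0; 0, 0, 1, -5])
    (S := !![14, -7, 0, 0; -7, 21, -7, -1; 0, -7, 14, 2; 0, -1, 2, 6])
    (Y := !![-1, -2, 0, -35; -2, 0, 0, 14; 0, 0, -1, 7; -35, 14, 7, 0]) (c := 28)

lemma not_modelEquiv_diamond :
    ¬ ModelEquiv (ofEdges {(0, 1), (2, 0), (2, 1), (0, 3), (1, 3)})
      (ofEdges ({(1, 0), (2, 0), (2, 1), (0, 3), (1, 3)} : Finset (Fin 4 × Fin 4))) :=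
  not_modelEquiv_of_separated
    (M := !![-4, 0, 0, 0; 4, -4, -4, 0; 0, 0, -4, 0; -4, 2, 0, -4])
    (S := !![16, 8, 0, -6; 8, 32, -8, 2; 0, -8, 16, -2; -6, 2, -2, 23])
    (Y := !![-33, 12, -3, -72; 12, -9, 15, 156; -3, 15, 77, 556; -72, 156, 556, 16]) (c := 64)

end Examples

section Local

variable {V W : Type*} {G G₁ G₂ : Digraph V} {a b c i j k l p q : V}

lemma IsDAG.adj_of_linked (hG : IsDAG G) (hne : a ≠ b) (hab : G.Adj a b) (hbc : G.Adj b c)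
    (hac : Linked G a c) : G.Adj a c :=
  hac.resolve_right fun hca ↦ hne (hG.eq_of_triangle hab hbc hca)

lemma injective_vecCons_iff {n : ℕ} {x : V} {u : Fin n → V} :
    Function.Injective (vecCons x u) ↔ x ∉ Set.range u ∧ Function.Injective u :=
  Fin.cons_injective_iff

lemma comap_eq_ofEdges (hG : IsDAG G) {f : W → V} (hf : f.Injective) {E N : Finset (W × W)}
    (hE : ∀ e ∈ E, G.Adj (f e.1) (f e.2)) (hN : ∀ e ∈ N, ¬ Linked G (f e.1) (f e.2))
    (hcover : ∀ a b, a = b ∨ (a, b) ∈ E ∨ (b, a) ∈ E ∨ (a, b) ∈ N ∨ (b, a) ∈ N) :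
    comap G f = ofEdges E := by
  ext a b
  refine ⟨fun hab ↦ ?_, ?_⟩
  · obtain rfl | hmem | hmem | hmem | hmem := hcover a b
    · exact .inl rfl
    · exact .inr hmem
    · exact .inl (hf (hG.antisymm hab (hE _ hmem)))
    · exact (hN _ hmem (.inl hab)).elim
    · exact (hN _ hmem (.inr hab)).elim
  · rintro (rfl | hmem)
    · exact hG.loop _
    · exact hE _ hmem

/-- `G₁` and `G₂` are DAGs with the same skeleton that are model equivalent on every set of at most
four vertices. -/
structure LocallyEquiv (G₁ G₂ : Digraph V) : Prop where
  isDAG₁ : IsDAG G₁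
  isDAG₂ : IsDAG G₂
  link : ∀ a b, Linked G₁ a b ↔ Linked G₂ a b
  equiv : ∀ n ≤ 4, ∀ f : Fin n → V, f.Injective → ModelEquiv (comap G₁ f) (comap G₂ f)

namespace LocallyEquiv

lemma symm (h : LocallyEquiv G₁ G₂) : LocallyEquiv G₂ G₁ where
  isDAG₁ := h.isDAG₂
  isDAG₂ := h.isDAG₁
  link a b := (h.link a b).symm
  equiv n hn f hf := (h.equiv n hn f hf).symm

lemma modelEquiv_ofEdges (h : LocallyEquiv G₁ G₂) {n : ℕ} {f : Fin n → V} (hf : f.Injective)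
    {E₁ E₂ N : Finset (Fin n × Fin n)} (hE₁ : ∀ e ∈ E₁, G₁.Adj (f e.1) (f e.2))
    (hE₂ : ∀ e ∈ E₂, G₂.Adj (f e.1) (f e.2)) (hN : ∀ e ∈ N, ¬ Linked G₁ (f e.1) (f e.2))
    (hn : n ≤ 4 := by decide)
    (hcover₁ : ∀ a b, a = b ∨ (a, b) ∈ E₁ ∨ (b, a) ∈ E₁ ∨ (a, b) ∈ N ∨ (b, a) ∈ N := by decide)
    (hcover₂ : ∀ a b, a = b ∨ (a, b) ∈ E₂ ∨ (b, a) ∈ E₂ ∨ (a, b) ∈ N ∨ (b, a) ∈ N := by decide) :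
    ModelEquiv (ofEdges E₁) (ofEdges E₂) := by
  have hN₂ : ∀ e ∈ N, ¬ Linked G₂ (f e.1) (f e.2) := fun e he ↦ (h.link _ _).not.1 (hN e he)
  rw [← comap_eq_ofEdges h.isDAG₁ hf hE₁ hN hcover₁, ← comap_eq_ofEdges h.isDAG₂ hf hE₂ hN₂ hcover₂]
  exact h.equiv n hn f hf

lemma linked_of_linked (h : LocallyEquiv G₁ G₂) (hij : G₁.Adj i j) (hji : G₂.Adj j i)
    (hpi : Linked G₁ p i) : Linked G₁ p j := by
  by_contra hpj
  have hf : Function.Injective ![p, i, j] := by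
    have hne_pi : p ≠ i := fun e ↦ hpj (e ▸ .inl hij)
    have hne_pj : p ≠ j := fun e ↦ hpj (e ▸ .inl (h.isDAG₁.loop p))
    have hne_ij : i ≠ j := fun e ↦ hpj (e ▸ hpi)
    simp [injective_vecCons_iff, Function.injective_of_subsingleton, hne_pi, hne_pj, hne_ij]
  have hN : ∀ e ∈ ({(0, 2)} : Finset _), ¬ Linked G₁ (![p, i, j] e.1) (![p, i, j] e.2) := by
    simpa using hpj
  obtain hpi₂ | hip₂ := (h.link p i).1 hpi <;> obtain hpi₁ | hip₁ := hpi
  · exact not_modelEquiv_collider_chain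
      (h.modelEquiv_ofEdges hf (by simp [*]) (by simp [*]) hN).symm
  · exact not_modelEquiv_collider_fork
      (h.modelEquiv_ofEdges hf (by simp [*]) (by simp [*]) hN).symm
  · exact not_modelEquiv_chain_reversedChain
      (h.modelEquiv_ofEdges hf (by simp [*]) (by simp [*]) hN)
  · exact not_modelEquiv_fork_chain
      (h.modelEquiv_ofEdges hf (by simp [*]) (by simp [*]) hN)

lemma linked_iff_linked (h : LocallyEquiv G₁ G₂) (hij : G₁.Adj i j) (hji : G₂.Adj j i) (p : V) :
    Linked G₁ p i ↔ Linked G₁ p j := by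
  refine ⟨h.linked_of_linked hij hji, fun hpj ↦ ?_⟩
  rw [h.link] at hpj ⊢
  exact h.symm.linked_of_linked hji hij hpj

lemma adj_of_not_linked_head (h : LocallyEquiv G₁ G₂) (hab : G₁.Adj a b) (hca : Linked G₁ c a)
    (hcb : ¬ Linked G₁ c b) : G₂.Adj a b :=
  ((h.link a b).1 (.inl hab)).resolve_right fun hba ↦
    hcb ((h.linked_iff_linked hab hba c).1 hca)

lemma adj_of_not_linked_tail (h : LocallyEquiv G₁ G₂) (hab : G₁.Adj a b) (hca : ¬ Linked G₁ c a)
    (hcb : Linked G₁ c b) : G₂.Adj a b :=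
  ((h.link a b).1 (.inl hab)).resolve_right fun hba ↦
    hca ((h.linked_iff_linked hab hba c).2 hcb)

lemma linked_of_adj_of_linked (h : LocallyEquiv G₁ G₂) (hij : (i, j) ∈ reversedEdges G₁ G₂)
    (hpi : G₁.Adj p i) (hpq : Linked G₁ p q) : Linked G₁ q i := by
  obtain ⟨hne, hij, hji⟩ : i ≠ j ∧ G₁.Adj i j ∧ G₂.Adj j i := hij
  by_contra hqi
  have hlink := h.linked_iff_linked hij hji
  have hqj : ¬ Linked G₁ q j := (hlink q).not.1 hqi
  have hne_ip : i ≠ p := fun e ↦ hqi (e ▸ hpq.symm)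
  have hpj : G₁.Adj p j := h.isDAG₁.adj_of_linked hne_ip.symm hpi hij ((hlink p).1 (.inl hpi))
  have hpi₂ : G₂.Adj p i := h.adj_of_not_linked_head hpi hpq.symm hqi
  have hpj₂ : G₂.Adj p j := h.adj_of_not_linked_head hpj hpq.symm hqj
  have hf : Function.Injective ![i, j, p, q] := by
    have hne_iq : i ≠ q := fun e ↦ hqi (e ▸ .inl (h.isDAG₁.loop i))
    have hne_jp : j ≠ p := fun e ↦ hqj (e ▸ hpq.symm)
    have hne_jq : j ≠ q := fun e ↦ hqj (e ▸ .inl (h.isDAG₁.loop j))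
    have hne_pq : p ≠ q := fun e ↦ hqi (e ▸ .inl hpi)
    simp [injective_vecCons_iff, Function.injective_of_subsingleton, hne, hne_ip, hne_iq, hne_jp,
      hne_jq, hne_pq]
  have hN : ∀ e ∈ ({(3, 0), (3, 1)} : Finset _),
      ¬ Linked G₁ (![i, j, p, q] e.1) (![i, j, p, q] e.2) := by
    simpa using ⟨hqi, hqj⟩
  obtain hpq | hqp := hpq
  · have hpq₂ : G₂.Adj p q :=
      h.adj_of_not_linked_head hpq (.inr hpi) fun hiq ↦ hqi hiq.symm
    exact not_modelEquiv_triangle_sourceChild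
      (h.modelEquiv_ofEdges hf (by simp [*]) (by simp [*]) hN)
  · have hqp₂ : G₂.Adj q p :=
      h.adj_of_not_linked_tail hqp (fun hiq ↦ hqi hiq.symm) (.inr hpi)
    exact not_modelEquiv_triangle_sourceParent
      (h.modelEquiv_ofEdges hf (by simp [*]) (by simp [*]) hN)

lemma linked_of_adj_of_adj (h : LocallyEquiv G₁ G₂) (hij : (i, j) ∈ reversedEdges G₁ G₂)
    (hik : G₁.Adj i k) (hkl : G₁.Adj k l) : Linked G₁ l i := by
  obtain ⟨hne, hij, hji⟩ : i ≠ j ∧ G₁.Adj i j ∧ G₂.Adj j i := hij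
  by_contra hli
  have hlink := h.linked_iff_linked hij hji
  have hlj : ¬ Linked G₁ l j := (hlink l).not.1 hli
  have hkj : Linked G₁ k j := (hlink k).1 (.inr hik)
  have hne_jk : j ≠ k := fun e ↦ hlj (e ▸ .inr hkl)
  have hik₂ : G₂.Adj i k := h.adj_of_not_linked_tail hik hli (.inr hkl)
  have hkl₂ : G₂.Adj k l := h.adj_of_not_linked_head hkl (.inl hik) fun hil ↦ hli hil.symm
  have hjk₂ : G₂.Adj j k := h.isDAG₂.adj_of_linked hne.symm hji hik₂ ((h.link k j).1 hkj).symm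
  have hjk : G₁.Adj j k := hkj.symm.resolve_right fun hkj ↦
    hne_jk (h.isDAG₂.antisymm hjk₂ (h.adj_of_not_linked_head hkj (.inr hkl) hlj))
  have hf : Function.Injective ![i, j, k, l] := by
    have hne_ik : i ≠ k := fun e ↦ hli (e ▸ .inr hkl)
    have hne_il : i ≠ l := fun e ↦ hli (e ▸ .inl (h.isDAG₁.loop i))
    have hne_jl : j ≠ l := fun e ↦ hlj (e ▸ .inl (h.isDAG₁.loop j))
    have hne_kl : k ≠ l := fun e ↦ hli (e ▸ .inr hik)
    simp [injective_vecCons_iff, Function.injective_of_subsingleton, hne, hne_ik, hne_il, hne_jk,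
      hne_jl, hne_kl]
  have hN : ∀ e ∈ ({(3, 0), (3, 1)} : Finset _),
      ¬ Linked G₁ (![i, j, k, l] e.1) (![i, j, k, l] e.2) := by
    simpa using ⟨hli, hlj⟩
  exact not_modelEquiv_triangle_sinkChild
    (h.modelEquiv_ofEdges hf (by simp [*]) (by simp [*]) hN)

lemma linked_parent_child (h : LocallyEquiv G₁ G₂) (hij : (i, j) ∈ reversedEdges G₁ G₂)
    (hpi : G₁.Adj p i) (hik : G₁.Adj i k) : Linked G₁ p k := by
  obtain ⟨hne, hij, hji⟩ : i ≠ j ∧ G₁.Adj i j ∧ G₂.Adj j i := hij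
  by_contra hpk
  have hkp : ¬ Linked G₁ k p := fun hkp ↦ hpk hkp.symm
  have hlink := h.linked_iff_linked hij hji
  have hlink_pj : Linked G₁ p j := (hlink p).1 (.inl hpi)
  have hlink_kj : Linked G₁ k j := (hlink k).1 (.inr hik)
  have hne_ip : i ≠ p := fun e ↦ hpk (e ▸ .inl hik)
  have hne_jk : j ≠ k := fun e ↦ hpk (e ▸ hlink_pj)
  have hpj : G₁.Adj p j := h.isDAG₁.adj_of_linked hne_ip.symm hpi hij hlink_pj
  have hpi₂ : G₂.Adj p i := h.adj_of_not_linked_tail hpi hkp (.inr hik)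
  have hik₂ : G₂.Adj i k := h.adj_of_not_linked_head hik (.inl hpi) hpk
  have hpj₂ : G₂.Adj p j := h.adj_of_not_linked_tail hpj hkp hlink_kj
  have hjk₂ : G₂.Adj j k :=
    h.isDAG₂.adj_of_linked hne.symm hji hik₂ ((h.link k j).1 hlink_kj).symm
  have hjk : G₁.Adj j k := hlink_kj.symm.resolve_right fun hkj ↦
    hne_jk (h.isDAG₂.antisymm hjk₂ (h.adj_of_not_linked_tail hkj hpk hlink_pj))
  have hf : Function.Injective ![i, j, p, k] := by
    have hne_ik : i ≠ k := fun e ↦ hpk (e ▸ .inl hpi)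
    have hne_jp : j ≠ p := fun e ↦ hkp (e ▸ hlink_kj)
    have hne_pk : p ≠ k := fun e ↦ hpk (e ▸ .inl (h.isDAG₁.loop p))
    simp [injective_vecCons_iff, Function.injective_of_subsingleton, hne, hne_ip, hne_ik, hne_jp,
      hne_jk, hne_pk]
  have hN : ∀ e ∈ ({(2, 3)} : Finset _),
      ¬ Linked G₁ (![i, j, p, k] e.1) (![i, j, p, k] e.2) := by
    simpa using hpk
  exact not_modelEquiv_diamond
    (h.modelEquiv_ofEdges hf (by simp [*]) (by simp [*]) hN)

theorem isReversible (h : LocallyEquiv G₁ G₂) (hij : (i, j) ∈ reversedEdges G₁ G₂) :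
    IsReversible G₁ i j where
  twin := h.linked_iff_linked hij.2.1 hij.2.2
  parent _ _ := h.linked_of_adj_of_linked hij
  child _ _ := h.linked_of_adj_of_adj hij
  through _ _ := h.linked_parent_child hij

end LocallyEquiv

end Local

section Skeleton

variable {V : Type*} {G₁ G₂ : Digraph V} {a b : V}

lemma skeleton_adj_iff {G : Digraph V} : (skeleton G).Adj a b ↔ a ≠ b ∧ Linked G a b :=
  SimpleGraph.fromRel_adj ..

lemma skeleton_eq_iff (hG₁ : IsDAG G₁) (hG₂ : IsDAG G₂) :
    skeleton G₁ = skeleton G₂ ↔ ∀ a b, Linked G₁ a b ↔ Linked G₂ a b := by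
  refine ⟨fun h a b ↦ ?_, fun h ↦ ?_⟩
  · obtain rfl | hne := eq_or_ne a b
    · exact iff_of_true (.inl (hG₁.loop a)) (.inl (hG₂.loop a))
    · have hadj : (skeleton G₁).Adj a b ↔ (skeleton G₂).Adj a b := by rw [h]
      rwa [skeleton_adj_iff, skeleton_adj_iff, and_iff_right hne, and_iff_right hne] at hadj
  · ext a b
    simp only [skeleton_adj_iff, h]

variable [Fintype V] [DecidableEq V]

lemma ModelEquiv.linked_of_adj (h : ModelEquiv G₁ G₂) (hG₁ : IsDAG G₁) (hG₂ : IsDAG G₂)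
    (hab : G₁.Adj a b) : Linked G₂ a b := by
  by_contra hlink
  have hne : a ≠ b := fun e ↦ hlink (e ▸ .inl (hG₂.loop a))
  have hf : Function.Injective ![a, b] := injective_pair_iff_ne.2 hne
  have h' := h.comap hG₁.loop hG₂.loop hf
  rw [comap_eq_ofEdges hG₁ hf (E := {(0, 1)}) (N := ∅) (by simpa) (by simp) (by decide),
    comap_eq_ofEdges hG₂ hf (E := ∅) (N := {(0, 1)}) (by simp) (by simpa) (by decide)] at h'
  exact not_modelEquiv_edge_empty h'

lemma ModelEquiv.linked_iff (h : ModelEquiv G₁ G₂) (hG₁ : IsDAG G₁) (hG₂ : IsDAG G₂) (a b : V) :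
    Linked G₁ a b ↔ Linked G₂ a b :=
  ⟨fun hab ↦ hab.elim (h.linked_of_adj hG₁ hG₂) fun hba ↦ (h.linked_of_adj hG₁ hG₂ hba).symm,
    fun hab ↦ hab.elim (h.symm.linked_of_adj hG₂ hG₁)
      fun hba ↦ (h.symm.linked_of_adj hG₂ hG₁ hba).symm⟩

lemma modelEquiv_comap_of_induce {W : Type*} [Fintype W] [DecidableEq W] {m : ℕ}
    (hV : m ≤ Fintype.card V) (hW : Fintype.card W ≤ m) (h₁ : ∀ v, G₁.Adj v v)
    (h₂ : ∀ v, G₂.Adj v v)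
    (h : ∀ K : Finset V, K.card = m → ModelEquiv (induce G₁ K) (induce G₂ K)) {f : W → V}
    (hf : f.Injective) : ModelEquiv (comap G₁ f) (comap G₂ f) := by
  obtain ⟨K, hfK, -, hK⟩ := Finset.exists_subsuperset_card_eq
    (Finset.subset_univ (Finset.univ.map ⟨f, hf⟩)) (by simpa using hW) hV
  have hmem (x : W) : f x ∈ K := hfK (Finset.mem_map_of_mem ⟨f, hf⟩ (Finset.mem_univ x))
  let g (x : W) : K := ⟨f x, hmem x⟩
  have hg : g.Injective := fun x y hxy ↦ hf (congrArg Subtype.val hxy)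
  exact ModelEquiv.comap (G₁ := induce G₁ K) (G₂ := induce G₂ K) (fun v ↦ h₁ v) (fun v ↦ h₂ v) hg
    (h K hK)

end Skeleton

end Lyapunov

theorem mainTheorem1 {V : Type*} [Fintype V] [DecidableEq V] (hV : 4 ≤ Fintype.card V)
    (G₁ G₂ : Digraph V) (h₁ : Lyapunov.IsDAG G₁) (h₂ : Lyapunov.IsDAG G₂) :
    Lyapunov.ModelEquiv G₁ G₂ ↔
      Lyapunov.skeleton G₁ = Lyapunov.skeleton G₂ ∧
        ∀ K : Finset V, K.card = 4 →
          Lyapunov.ModelEquiv (Lyapunov.induce G₁ K) (Lyapunov.induce G₂ K) := by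
  rw [Lyapunov.skeleton_eq_iff h₁ h₂]
  constructor
  · exact fun h ↦ ⟨h.linked_iff h₁ h₂, fun K _ ↦
      h.comap h₁.loop h₂.loop (f := fun v : K ↦ (v : V)) Subtype.val_injective⟩
  · rintro ⟨hlink, hK⟩
    have hlocal : Lyapunov.LocallyEquiv G₁ G₂ :=
      { isDAG₁ := h₁
        isDAG₂ := h₂
        link := hlink
        equiv := fun _ hn _ hf ↦
          Lyapunov.modelEquiv_comap_of_induce hV (by simpa using hn) h₁.loop h₂.loop hK hf }
    exact Lyapunov.modelEquiv_of_isReversible h₁ h₂ hlink fun _ _ ↦ hlocal.isReversible
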